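/- Let $n\ge 1$ and $d=2n+1$. There is a constant $C>0$ depending only on $n$ (equivalently on $d$) such that the following holds for every finite field $\mathbb F$ of characteristic different from $2$ and every nontrivial additive character $e:\mathbb F\to\mathbb C$. For complementary subspaces $W,V$ of $\mathbb F^{2n}$ (that is, $\mathbb F^{2n}=W\oplus V$) of dimension $n$, and for $G:\mathbb F^{2n}\times\mathbb F\to\mathbb C$ and $g:\mathbb F^{2n}\to\mathbb C$, put $$\|G\|_{L^q_{V,t}L^p_W}=\Big(\sum_{v\in V,\,t\in\mathbb F}\Big(\sum_{w\in W}|G(w+v,t)|^p\Big)^{q/p}\Big)^{1/q},\qquad \|g\|_{L^q_VL^p_W(d\sigma)}=\Big(|\mathbb F|^{-n}\sum_{v\in V}\Big(|\mathbb F|^{-n}\sum_{w\in W}|g(w+v)|^p\Big)^{q/p}\Big)^{1/q},$$ and $\|g\|_{L^p(d\sigma)}=\big(|\mathbb F|^{-2n}\sum_{\xi\in\mathbb F^{2n}}|g(\xi)|^p\big)^{1/p}$. (1) Let $A$ be an invertible symmetric $2n\times 2n$ matrix over $\mathbb F$, $x\circ y=x^{T}Ay$, and let $W,V$ be complementary $n$-dimensional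 subspaces of $\mathbb F^{2n}$ that are totally isotropic ($u\circ u=0$ for all $u\in W$ and all $u\in V$), so that the form has Witt index $n$ and $W,V$ are maximal totally isotropic. For $f:\mathbb F^{2n}\to\mathbb C$ put $$(f\,d\sigma)^\vee(x,t)=|\mathbb F|^{-2n}\sum_{\xi\in\mathbb F^{2n}}f(\xi)\,e\big(\xi\circ x+(\xi\circ\xi)t\big).$$ Then $$\|(f\,d\sigma)^\vee\|_{L^{(2d+2)/(d-1)}_{V,t}L^2_W}\le C\,\|f\|_{L^{(2d+2)/(d-1)}_{V}L^2_W(d\sigma)}.$$ For $A=I$ this is the extension operator of the paraboloid $\mathcal P=\{(\xi,\xi\cdot\xi):\xi\in\mathbb F^{2n}\}\subset\mathbb F^{d}$. (2) Let $W,V$ be complementary $n$-dimensional subspaces of $\mathbb F^{2n}$, totally isotropic for the standard dot product (so that $x\cdot x$ has Witt index $n$). For $f:\mathbb F^{2n}\times\mathbb F\to\mathbb C$ let $\hat f(\xi,\tau)=\sum_{x,t}f(x,t)\,e(-x\cdot\xi-t\tau)$, and identify the restriction of $\hat f$ to $\mathcal P$ with the function $\xi\mapsto\hat f(\xi,\xi\cdot\xi)$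 on $\mathbb F^{2n}$. Then $$\|\hat f\|_{L^{(2d+2)/(d+3)}_VL^2_W(\mathcal P,d\sigma)}\le C\,\|f\|_{L^{(2d+2)/(d+3)}_{V,t}L^2_W}\quad\text{and}\quad \|\hat f\|_{L^{(2d+2)/(d+3)}(\mathcal P,d\sigma)}\le C\,\|f\|_{L^{(2d+2)/(d+3)}_{V,t}L^2_W}.$$ -/

import Mathlib

open scoped Matrix BigOperators

noncomputable section

/-- The symmetric bilinear form `x ∘ y = xᵀ A y` attached to a matrix `A`. The choice `A = 1` is the
standard dot product. -/
def formOf {F : Type*} [Field F] {m : ℕ} (A : Matrix (Fin m) (Fin m) F) (x y : Fin m → F) : F :=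
  x ⬝ᵥ (A *ᵥ y)

/-- `U` is totally isotropic for `A`: the quadratic form `x ∘ x` vanishes on `U`. -/
def TotallyIsotropic {F : Type*} [Field F] {m : ℕ} (A : Matrix (Fin m) (Fin m) F)
    (U : Submodule F (Fin m → F)) : Prop :=
  ∀ u ∈ U, formOf A u u = 0

/-- The extension operator `(f dσ)^∨(x,t) = |F|^{-m} ∑_ξ f(ξ) e(ξ ∘ x + (ξ ∘ ξ) t)` of the quadratic
surface `{(ξ, ξ ∘ ξ)}`, where functions on the surface are identified with functions on `F^m`. -/
def extension {F : Type*} [Field F] [Fintype F] {m : ℕ} (e : AddChar F ℂ)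
    (A : Matrix (Fin m) (Fin m) F) (f : (Fin m → F) → ℂ) (z : (Fin m → F) × F) : ℂ :=
  ((Fintype.card F : ℂ) ^ m)⁻¹ *
    ∑ ξ : Fin m → F, f ξ * e (formOf A ξ z.1 + formOf A ξ ξ * z.2)

/-- The Fourier transform on `F^{m+1} = F^m × F` with respect to the standard dot product and
counting measure: `∑_{(x,t)} f(x,t) e(-(x·ξ + tτ))`. -/
def fourierTransform {F : Type*} [Field F] [Fintype F] {m : ℕ} (e : AddChar F ℂ)
    (f : (Fin m → F) × F → ℂ) (ζ : (Fin m → F) × F) : ℂ :=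
  ∑ z : (Fin m → F) × F, f z * e (-(z.1 ⬝ᵥ ζ.1 + z.2 * ζ.2))

/-- The restriction of a function on `F^m × F` to the paraboloid `{(ξ, ξ·ξ)}`, as a function
of `ξ`. -/
def restrictParaboloid {F : Type*} [Field F] {m : ℕ} (g : (Fin m → F) × F → ℂ)
    (ξ : Fin m → F) : ℂ :=
  g (ξ, ξ ⬝ᵥ ξ)

open Classical in
/-- The mixed norm `‖G‖_{L^q_{V,t} L^p_W}` with respect to counting measure: the inner variable
runs over `W`, the outer variables over `V` and `F`. -/
def mixedNormSpace {F : Type*} [Field F] [Fintype F] {m : ℕ} (W V : Submodule F (Fin m → F))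
    (p q : ℝ) (G : (Fin m → F) × F → ℂ) : ℝ :=
  (∑ v : V, ∑ t : F, (∑ w : W, ‖G ((w : Fin m → F) + (v : Fin m → F), t)‖ ^ p) ^ (q / p)) ^ (1 / q)

open Classical in
/-- The mixed norm `‖f‖_{L^q_V L^p_W(dσ)}` with respect to the normalized counting measures on
`W` (inner variable) and `V` (outer variable). -/
def mixedNormSurface {F : Type*} [Field F] [Fintype F] {m : ℕ} (W V : Submodule F (Fin m → F))
    (p q : ℝ) (f : (Fin m → F) → ℂ) : ℝ :=
  ((Fintype.card V : ℝ)⁻¹ * ∑ v : V,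
    ((Fintype.card W : ℝ)⁻¹ * ∑ w : W, ‖f ((w : Fin m → F) + (v : Fin m → F))‖ ^ p) ^ (q / p)) ^
      (1 / q)

/-- The norm of `L^p(dσ)` for the normalized surface measure, functions on the surface being
identified with functions on `F^m`. -/
def normSurface {F : Type*} [Field F] [Fintype F] {m : ℕ} (p : ℝ) (f : (Fin m → F) → ℂ) : ℝ :=
  (((Fintype.card F : ℝ) ^ m)⁻¹ * ∑ ξ : Fin m → F, ‖f ξ‖ ^ p) ^ (1 / p)

end

/-! The mechanism is Plancherel twice with a Kakeya maximal inequality in between. Put $q=|\mathbb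
F|$, $\xi=w+v$ and $x=w'+v'$. Isotropy of $W$ and $V$ kills every term of the phase except
$w\circ(v'+2tv)+v\circ w'$. The variable $w'$ meets only $v$, so Plancherel in $w'$ turns the inner
$L^2_W$ norm squared into $q^{-3n}\sum_v h_v(v'+2tv)$, where $h_v(y)=|\sum_w f(w+v)e(w\circ y)|^2$.
This is a superposition of nonnegative functions constant along lines of $V\times\mathbb F$, with
one direction for each $v$, and it has to be bounded in $L^{(n+1)/n}$, since half of $(2d+2)/(d-1)$
is $(n+1)/n$. That bound is dual to the Kakeya maximal inequality in $\mathbb F^{n+1}$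
(`kakeya_maximal`, `sum_rpow_le_of_lines`). Plancherel on each fibre then evaluates $\sum_y
h_v(y)=q^n\sum_w|f(w+v)|^2$, and all powers of $q$ cancel.

The Kakeya inequality comes from the polynomial method with multiplicities. Forms built from Hermite
interpolants at the directions are mapped to their jets at the points of $\mathbb F^{n+1}$. If all
jets of a combination vanish, then it vanishes along the chosen line in each direction, and along
nilpotent perturbations of that line. Its leading coefficients there are jets at infinity, and these
recover the coefficients of the combination. Hence the map is injective, and comparing dimensions
gives the inequality (`kakeya_nat`).

Restriction is the adjoint statement for $A=I$, and the unmixed norm on the surface is smaller by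
Jensen on each fibre. -/

/-! ### Hermite interpolation and vanishing to high order -/

/-- Hermite interpolation at all points of a finite field: the dual basis to the Taylor
coefficients of order less than `m`. -/
theorem exists_hermite_basis (F : Type*) [Field F] [Fintype F] [DecidableEq F] (m : ℕ) :
    ∃ H : F → ℕ → Polynomial F, (∀ a i, (H a i).natDegree ≤ m * Fintype.card F - 1) ∧
      ∀ a, ∀ i < m, ∀ b, ∀ j < m,
        (Polynomial.taylor b (H a i)).coeff j = if b = a ∧ j = i then 1 else 0 := by
  classical
  let N := m * Fintype.card F
  let L : Polynomial.degreeLT F N →ₗ[F] (F × Fin m → F) :=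
    LinearMap.pi fun z => (Polynomial.lcoeff F z.2) ∘ₗ (Polynomial.taylor z.1) ∘ₗ
      (Polynomial.degreeLT F N).subtype
  have hinj : Function.Injective L := by
    rw [← LinearMap.ker_eq_bot, LinearMap.ker_eq_bot']
    rintro ⟨P, hP⟩ h
    rw [Subtype.ext_iff]
    change P = 0
    -- A polynomial in the kernel is divisible by a product of degree `m * q`, which exceeds its own
    -- degree. With equal dimensions, injectivity makes `L` bijective.
    have hdvd : (∏ b : F, (Polynomial.X - Polynomial.C b) ^ m) ∣ P := by
      refine Finset.prod_dvd_of_coprime (fun a _ b _ hab => ?_) fun b _ => ?_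
      · exact (Polynomial.pairwise_coprime_X_sub_C Function.injective_id hab).pow
      · rw [Polynomial.X_sub_C_pow_dvd_iff, Polynomial.X_pow_dvd_iff]
        intro j hj
        exact congrFun h (b, ⟨j, hj⟩)
    by_contra hne
    have h1 := Polynomial.natDegree_le_of_dvd hdvd hne
    rw [Polynomial.natDegree_prod_of_monic _ _
      fun b _ => (Polynomial.monic_X_sub_C b).pow m] at h1
    have h2 := (Polynomial.natDegree_lt_iff_degree_lt hne).2 (Polynomial.mem_degreeLT.1 hP)
    simp [N, mul_comm] at h1 h2
    omega
  have hfr : Module.finrank F (Polynomial.degreeLT F N) = Module.finrank F (F × Fin m → F) := by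
    rw [LinearEquiv.finrank_eq (Polynomial.degreeLTEquiv F N)]
    simp [N, mul_comm]
  have : Module.Finite F (Polynomial.degreeLT F N) :=
    Module.Finite.equiv (Polynomial.degreeLTEquiv F N).symm
  let E := L.linearEquivOfInjective hinj hfr
  -- The value 0 for `i ≥ m` makes the degree bound hold for every `i`.
  refine ⟨fun a i => if h : i < m then (E.symm (Pi.single (a, ⟨i, h⟩) 1) : Polynomial F) else 0,
    fun a i => ?_, fun a i hi b j hj => ?_⟩
  · by_cases h : i < m
    · simp only [h, dite_true]
      set Q := E.symm (Pi.single (a, ⟨i, h⟩) 1)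
      have hQ := Polynomial.mem_degreeLT.1 Q.2
      by_cases h0 : (Q : Polynomial F) = 0
      · simp [h0]
      · have := (Polynomial.natDegree_lt_iff_degree_lt h0).2 hQ
        exact Nat.le_sub_one_of_lt this
    · simp [h]
  · simp only [hi, dite_true]
    have : E (E.symm (Pi.single (a, ⟨i, hi⟩) 1)) (b, ⟨j, hj⟩) =
        (Pi.single (a, ⟨i, hi⟩) 1 : F × Fin m → F) (b, ⟨j, hj⟩) := by
      rw [LinearEquiv.apply_symm_apply]
    refine Eq.trans (Eq.trans ?_ this) ?_
    · rfl
    · simp [Pi.single_apply, Prod.ext_iff]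

/-- A polynomial over an algebra with a nilpotent ideal which vanishes to high order along that
ideal at all points of a finite field is zero. -/
theorem Polynomial.eq_zero_of_forall_mem_pow {F : Type*} [Field F] [Fintype F] {A : Type*}
    [CommRing A] [Algebra F A] (u : Ideal A) (k D : ℕ) (hu : u ^ k = ⊥) (Q : Polynomial A)
    (f : F → ℕ)
    (hQ : ∀ τ, Q ∈ (Ideal.span {Polynomial.X - Polynomial.C (algebraMap F A τ)} ⊔
      u.map Polynomial.C) ^ (f τ))
    (hdeg : Q.natDegree ≤ D) (hD : D + k * Fintype.card F < ∑ τ, f τ) : Q = 0 := by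
  nontriviality A
  have hdvd : (∏ τ : F, (Polynomial.X - Polynomial.C (algebraMap F A τ)) ^ (f τ - k)) ∣ Q := by
    refine Finset.prod_dvd_of_coprime (fun a _ b _ hab => ?_) fun τ _ => ?_
    · refine (Polynomial.isCoprime_X_sub_C_of_isUnit_sub ?_).pow
      rw [← map_sub]
      exact (sub_ne_zero.2 hab).isUnit.map _
    · rcases le_total k (f τ) with h | h
      · have h1 := hQ τ
        rw [← Nat.sub_add_cancel h] at h1
        -- In an expansion of total order `f τ`, fewer than `k` factors can come from `u`, so at
        -- least `f τ - k` factors `X - τ` remain.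
        have h2 := Ideal.sup_pow_add_le_pow_sup_pow h1
        rw [← Ideal.map_pow, hu, Ideal.map_bot, sup_bot_eq, Ideal.span_singleton_pow,
          Ideal.mem_span_singleton] at h2
        exact h2
      · simp [Nat.sub_eq_zero_of_le h]
  have hmonic : (∏ τ : F, (Polynomial.X - Polynomial.C (algebraMap F A τ)) ^ (f τ - k)).Monic :=
    Polynomial.monic_prod_of_monic _ _ fun τ _ => (Polynomial.monic_X_sub_C _).pow _
  by_contra hne
  refine hmonic.not_dvd_of_natDegree_lt hne ?_ hdvd
  rw [Polynomial.natDegree_prod_of_monic _ _ fun τ _ => (Polynomial.monic_X_sub_C _).pow _]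
  have h1 : ∀ τ : F, ((Polynomial.X - Polynomial.C (algebraMap F A τ)) ^ (f τ - k)).natDegree
      = f τ - k := fun τ => by
    rw [(Polynomial.monic_X_sub_C _).natDegree_pow]; simp
  simp only [h1]
  have h2 : ∑ τ, f τ ≤ ∑ τ : F, ((f τ - k) + k) := Finset.sum_le_sum fun τ _ => by omega
  rw [Finset.sum_add_distrib] at h2
  simp [mul_comm] at h2
  omega

/-- Vanishing is imposed on a box of exponents, not a simplex: each surviving monomial contains some
`X j ^ k`. A box has exactly `k ^ (number of variables)` conditions, which keeps the later count
free of binomials. -/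
theorem MvPolynomial.aeval_mem_pow {σ F B : Type*} [Fintype σ] [CommRing F] [CommRing B]
    [Algebra F B] (I : Ideal B) (k : ℕ) (P : MvPolynomial σ F)
    (hP : ∀ β : σ →₀ ℕ, (∀ j, β j < k) → P.coeff β = 0) (g : σ → B) (hg : ∀ j, g j ∈ I) :
    MvPolynomial.aeval g P ∈ I ^ k := by
  rw [MvPolynomial.aeval_def, MvPolynomial.eval₂_eq']
  refine Ideal.sum_mem _ fun β hβ => Ideal.mul_mem_left _ _ ?_
  have : ∃ j, k ≤ β j := by
    by_contra! h
    exact (MvPolynomial.mem_support_iff.1 hβ) (hP β h)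
  obtain ⟨j, hj⟩ := this
  refine Ideal.mem_of_dvd _ (Finset.dvd_prod_of_mem _ (Finset.mem_univ j)) ?_
  exact Ideal.pow_le_pow_right hj (Ideal.pow_mem_pow (hg j) _)

/-! ### Product forms and their restriction to lines -/

/-- The homogenization to degree `e` of a polynomial, evaluated at `(a, b)`. -/
noncomputable def Polynomial.homogEval {F B : Type*} [CommSemiring F] [CommSemiring B] [Algebra F B]
    (e : ℕ) (h : Polynomial F) (a b : B) : B :=
  ∑ i ∈ Finset.range (e + 1), h.coeff i • (a ^ i * b ^ (e - i))

theorem Polynomial.map_homogEval {F B B' : Type*} [CommSemiring F] [CommSemiring B]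
    [CommSemiring B'] [Algebra F B] [Algebra F B'] (θ : B →ₐ[F] B') (e : ℕ) (h : Polynomial F)
    (a b : B) : θ (Polynomial.homogEval e h a b) = Polynomial.homogEval e h (θ a) (θ b) := by
  simp [Polynomial.homogEval]

section line
variable {F A : Type*} [CommRing F] [CommRing A] [Algebra F A]

theorem Polynomial.homogEval_line_summand (e i : ℕ) (hi : i ≤ e) (c w : A) :
    ((Polynomial.C c + Polynomial.C w * Polynomial.X) ^ i *
        (Polynomial.X : Polynomial A) ^ (e - i)).natDegree ≤ e ∧
    ((Polynomial.C c + Polynomial.C w * Polynomial.X) ^ i *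
        (Polynomial.X : Polynomial A) ^ (e - i)).coeff e = w ^ i := by
  have h1 : (Polynomial.C c + Polynomial.C w * Polynomial.X : Polynomial A).natDegree ≤ 1 := by
    compute_degree
  constructor
  · calc _ ≤ i * 1 + (e - i) := by
          refine Polynomial.natDegree_mul_le.trans (add_le_add ?_ (Polynomial.natDegree_X_pow_le _))
          exact Polynomial.natDegree_pow_le_of_le _ h1
      _ = e := by omega
  · conv_lhs => rw [show e = i * 1 + (e - i) by omega]
    rw [show i * 1 + (e - i) - i = e - i by omega, Polynomial.coeff_mul_X_pow,
      Polynomial.coeff_pow_of_natDegree_le h1]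
    simp

theorem Polynomial.natDegree_homogEval_line (e : ℕ) (h : Polynomial F) (c w : A) :
    (Polynomial.homogEval e h (Polynomial.C c + Polynomial.C w * Polynomial.X)
      (Polynomial.X : Polynomial A)).natDegree ≤ e :=
  Polynomial.natDegree_sum_le_of_forall_le _ _ fun i hi =>
    (Polynomial.natDegree_smul_le _ _).trans
      (Polynomial.homogEval_line_summand e i (Finset.mem_range_succ_iff.1 hi) c w).1

theorem Polynomial.coeff_homogEval_line (e : ℕ) (h : Polynomial F) (he : h.natDegree ≤ e)
    (c w : A) :
    (Polynomial.homogEval e h (Polynomial.C c + Polynomial.C w * Polynomial.X)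
      (Polynomial.X : Polynomial A)).coeff e = Polynomial.aeval w h := by
  rw [Polynomial.homogEval, Polynomial.finsetSum_coeff,
    Polynomial.aeval_eq_sum_range' (Nat.lt_succ_of_le he)]
  refine Finset.sum_congr rfl fun i hi => ?_
  rw [Polynomial.coeff_smul,
    (Polynomial.homogEval_line_summand e i (Finset.mem_range_succ_iff.1 hi) c w).2]

/-- The form of degree `D` which dehomogenizes to `∏ j, h j (y j)`. -/
noncomputable def Polynomial.prodForm {B : Type*} [CommRing B] [Algebra F B] {n : ℕ} (D e : ℕ)
    (h : Fin n → Polynomial F) (a : Fin n → B) (b : B) : B :=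
  b ^ (D - n * e) * ∏ j, Polynomial.homogEval e (h j) (a j) b

theorem Polynomial.natDegree_prodForm_line {n D e : ℕ} (hD : n * e ≤ D) (h : Fin n → Polynomial F)
    (c w : Fin n → A) :
    (Polynomial.prodForm D e h (fun j => Polynomial.C (c j) + Polynomial.C (w j) * Polynomial.X)
      (Polynomial.X : Polynomial A)).natDegree ≤ D := by
  refine Polynomial.natDegree_mul_le.trans ?_
  have h1 := Polynomial.natDegree_prod_le (Finset.univ : Finset (Fin n)) fun j =>
    Polynomial.homogEval e (h j) (Polynomial.C (c j) + Polynomial.C (w j) * Polynomial.X)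
      (Polynomial.X : Polynomial A)
  have h2 := h1.trans (Finset.sum_le_sum fun j _ => Polynomial.natDegree_homogEval_line e (h j)
    (c j) (w j))
  have h3 := Polynomial.natDegree_X_pow_le (R := A) (D - n * e)
  simp only [Finset.sum_const, Finset.card_univ, Fintype.card_fin, smul_eq_mul] at h2
  refine (add_le_add h3 h2).trans ?_
  omega

/-- The top coefficient of a form along a line is the value of the form at the point at infinity
`(w, 1)`, so it does not depend on the base point `c`. -/
theorem Polynomial.coeff_prodForm_line {n D e : ℕ} (hD : n * e ≤ D) (h : Fin n → Polynomial F)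
    (he : ∀ j, (h j).natDegree ≤ e) (c w : Fin n → A) :
    (Polynomial.prodForm D e h (fun j => Polynomial.C (c j) + Polynomial.C (w j) * Polynomial.X)
      (Polynomial.X : Polynomial A)).coeff D = ∏ j, Polynomial.aeval (w j) (h j) := by
  rw [Polynomial.prodForm, mul_comm]
  conv_lhs => rw [show D = (Finset.univ : Finset (Fin n)).card * e + (D - n * e) by simp; omega]
  rw [show (Finset.univ : Finset (Fin n)).card * e + (D - n * e) - n * e = D - n * e by simp,
    Polynomial.coeff_mul_X_pow, Polynomial.coeff_prod_of_natDegree_le _ _ e fun j _ =>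
      Polynomial.natDegree_homogEval_line e (h j) (c j) (w j)]
  exact Finset.prod_congr rfl fun j _ => Polynomial.coeff_homogEval_line e (h j) (he j) _ _

end line

theorem MvPolynomial.coeff_prod_aeval_X {F : Type*} [CommRing F] {n : ℕ}
    (p : Fin n → Polynomial F) (i : Fin n →₀ ℕ) :
    (∏ j, Polynomial.aeval (MvPolynomial.X j : MvPolynomial (Fin n) F) (p j)).coeff i =
      ∏ j, (p j).coeff (i j) := by
  classical
  obtain ⟨N, hN⟩ : ∃ N, ∀ j, (p j).natDegree < N ∧ i j < N := by
    refine ⟨∑ j, ((p j).natDegree + i j + 1), fun j => ?_⟩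
    have := Finset.single_le_sum (f := fun j => (p j).natDegree + i j + 1)
      (fun _ _ => Nat.zero_le _) (Finset.mem_univ j)
    omega
  have h1 : ∀ j, Polynomial.aeval (MvPolynomial.X j : MvPolynomial (Fin n) F) (p j) =
      ∑ a ∈ Finset.range N, MvPolynomial.C ((p j).coeff a) * MvPolynomial.X j ^ a := fun j => by
    rw [Polynomial.aeval_eq_sum_range' (hN j).1]
    exact Finset.sum_congr rfl fun a _ => by rw [MvPolynomial.smul_eq_C_mul]
  simp only [h1]
  rw [Finset.prod_univ_sum, MvPolynomial.coeff_sum]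
  have h2 : ∀ a : Fin n → ℕ, (∏ j, (MvPolynomial.C ((p j).coeff (a j)) * MvPolynomial.X j ^ a j)
      : MvPolynomial (Fin n) F) =
      MvPolynomial.monomial (Finsupp.equivFunOnFinite.symm a) (∏ j, (p j).coeff (a j)) := fun a => by
    rw [MvPolynomial.monomial_eq, Finset.prod_mul_distrib, map_prod]
    congr 1
    rw [Finsupp.prod_fintype _ _ (by simp)]
    simp
  simp only [h2, MvPolynomial.coeff_monomial]
  rw [Finset.sum_eq_single (i : Fin n → ℕ)]
  · simp
  · intro b _ hb
    rw [if_neg]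
    rintro rfl
    exact hb rfl
  · intro h
    exact absurd (Fintype.mem_piFinset.2 fun j => Finset.mem_range.2 (hN j).2) h

/-- The line `τ ↦ (c + τ w, τ)`, as a polynomial substitution. -/
noncomputable def linePoly {A : Type*} [CommRing A] {n : ℕ} (c w : Fin n → A) :
    Option (Fin n) → Polynomial A :=
  fun o => o.elim Polynomial.X fun j => Polynomial.C (c j) + Polynomial.C (w j) * Polynomial.X

/-- The direction `v` is perturbed by the nilpotent `u`. Relative to the point at parameter `τ`, the
coordinates of the perturbed line are `X - τ` and `v j (X - τ) + X u j`, all in the ideal `(X - τ,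
u)`. Vanishing at that point therefore places the restriction in its `f τ`-th power. -/
theorem aeval_linePoly_eq_zero {F : Type*} [Field F] [Fintype F] {A : Type*} [CommRing A]
    [Algebra F A] {n : ℕ} (f : F → ℕ) (y v : Fin n → F) (P : MvPolynomial (Option (Fin n)) F)
    (hP : ∀ τ, ∀ β : Option (Fin n) →₀ ℕ, (∀ j, β j < f τ) →
      (MvPolynomial.aeval (fun o : Option (Fin n) =>
        (MvPolynomial.X o + MvPolynomial.C (o.elim τ (y + τ • v)) :
          MvPolynomial (Option (Fin n)) F)) P).coeff β = 0)
    (u : Fin n → A) (I : Ideal A) (hu : ∀ j, u j ∈ I) (k D : ℕ) (hI : I ^ k = ⊥)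
    (hdeg : (MvPolynomial.aeval (linePoly (fun j => algebraMap F A (y j))
      (fun j => algebraMap F A (v j) + u j)) P).natDegree ≤ D)
    (hD : D + k * Fintype.card F < ∑ τ, f τ) :
    MvPolynomial.aeval (linePoly (fun j => algebraMap F A (y j))
      (fun j => algebraMap F A (v j) + u j)) P = 0 := by
  refine Polynomial.eq_zero_of_forall_mem_pow I k D hI _ f (fun τ => ?_) hdeg hD
  set J := Ideal.span {Polynomial.X - Polynomial.C (algebraMap F A τ)} ⊔ I.map Polynomial.C
  have hX : Polynomial.X - Polynomial.C (algebraMap F A τ) ∈ J :=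
    Ideal.mem_sup_left (Ideal.mem_span_singleton_self _)
  have key := MvPolynomial.aeval_mem_pow J (f τ) _ (hP τ)
    (fun o => linePoly (fun j => algebraMap F A (y j)) (fun j => algebraMap F A (v j) + u j) o -
      algebraMap F (Polynomial A) (o.elim τ (y + τ • v))) ?_
  · have hcomp : MvPolynomial.aeval (R := F) (linePoly (fun j => algebraMap F A (y j))
        (fun j => algebraMap F A (v j) + u j)) = (MvPolynomial.aeval (R := F)
          (fun o => linePoly (fun j => algebraMap F A (y j)) (fun j => algebraMap F A (v j) + u j) o -
            algebraMap F (Polynomial A) (o.elim τ (y + τ • v)))).comp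
          (MvPolynomial.aeval (fun o : Option (Fin n) =>
            (MvPolynomial.X o + MvPolynomial.C (o.elim τ (y + τ • v)) :
              MvPolynomial (Option (Fin n)) F))) := by
      refine MvPolynomial.algHom_ext fun o => ?_
      rw [AlgHom.comp_apply, MvPolynomial.aeval_X, MvPolynomial.aeval_X, map_add,
        MvPolynomial.aeval_X, MvPolynomial.aeval_C]
      ring
    rw [hcomp]
    exact key
  · rintro (_ | j)
    · exact hX
    · have h : linePoly (fun j => algebraMap F A (y j)) (fun j => algebraMap F A (v j) + u j)
          (some j) - algebraMap F (Polynomial A) ((some j).elim τ (y + τ • v)) =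
          Polynomial.C (algebraMap F A (v j)) * (Polynomial.X - Polynomial.C (algebraMap F A τ)) +
            Polynomial.X * Polynomial.C (u j) := by
        simp [linePoly, Polynomial.algebraMap_apply]
        ring
      rw [h]
      exact J.add_mem (J.mul_mem_left _ hX)
        (J.mul_mem_left _ (Ideal.mem_sup_right (Ideal.mem_map_of_mem _ (hu j))))

/-- The form of degree `D` which dehomogenizes to `∏ j, h j (y j)`, as a polynomial. -/
noncomputable def mvProdForm {F : Type*} [CommRing F] {n : ℕ} (D e : ℕ)
    (h : Fin n → Polynomial F) : MvPolynomial (Option (Fin n)) F :=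
  Polynomial.prodForm D e h (fun j => MvPolynomial.X (some j)) (MvPolynomial.X none)

/-- If a form of degree `D` (a combination of product forms) together with terms of lower degree
vanishes to high order along a line, then the jet of the form in the direction of the line
vanishes. -/
theorem coeff_taylor_eq_zero_of_line {F : Type*} [Field F] [Fintype F] {n : ℕ} (hn : 1 ≤ n)
    (f : F → ℕ) (y v : Fin n → F) {ι : Type*} (s : Finset ι) (c : ι → F) (D e : ι → ℕ)
    (h : ι → Fin n → Polynomial F) (hh : ∀ z ∈ s, ∀ j, (h z j).natDegree ≤ e z)
    (he : ∀ z ∈ s, n * e z ≤ D z)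
    (D₀ m : ℕ) (hDs : ∀ z ∈ s, c z ≠ 0 → D z ≤ D₀)
    (hP : ∀ τ, ∀ β : Option (Fin n) →₀ ℕ, (∀ j, β j < f τ) →
      (MvPolynomial.aeval (fun o : Option (Fin n) =>
        (MvPolynomial.X o + MvPolynomial.C (o.elim τ (y + τ • v)) :
          MvPolynomial (Option (Fin n)) F))
          (∑ z ∈ s, c z • mvProdForm (D z) (e z) (h z))).coeff β = 0)
    (hD : D₀ + n * m * Fintype.card F < ∑ τ, f τ) (i : Fin n → ℕ) (hi : ∀ j, i j < m) :
    ∑ z ∈ s with D z = D₀, c z * ∏ j, (Polynomial.taylor (v j) (h z j)).coeff (i j) = 0 := by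
  classical
  let I := MvPolynomial.idealOfVars (Fin n) F
  -- The perturbation of the direction is generic, truncated at order `n * m`: a multi-index with
  -- entries below `m` has total degree below `n * m`, so its coefficient survives.
  let A := MvPolynomial (Fin n) F ⧸ I ^ (n * m)
  let π : MvPolynomial (Fin n) F →ₐ[F] A := Ideal.Quotient.mkₐ F _
  let w : Fin n → A := fun j => algebraMap F A (v j) + π (MvPolynomial.X j)
  let θ := MvPolynomial.aeval (R := F) (linePoly (fun j => algebraMap F A (y j)) w)
  have hθ : ∀ z, θ (mvProdForm (D z) (e z) (h z)) =
      Polynomial.prodForm (D z) (e z) (h z) (fun j => Polynomial.C (algebraMap F A (y j)) +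
        Polynomial.C (w j) * Polynomial.X) Polynomial.X := by
    intro z
    simp [mvProdForm, Polynomial.prodForm, Polynomial.map_homogEval, θ, linePoly]
  have hzero : ∀ z ∈ s, c z = 0 ∨ D z ≤ D₀ := fun z hz => or_iff_not_imp_left.2 (hDs z hz)
  have hQ : θ (∑ z ∈ s, c z • mvProdForm (D z) (e z) (h z)) = 0 := by
    refine aeval_linePoly_eq_zero f y v _ hP (fun j => π (MvPolynomial.X j)) (I.map π)
      (fun j => Ideal.mem_map_of_mem _ (Ideal.subset_span ⟨j, rfl⟩)) (n * m) D₀ ?_ ?_ hD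
    · rw [← Ideal.map_pow]
      exact Ideal.map_quotient_self _
    · change (θ _).natDegree ≤ D₀
      rw [map_sum]
      refine Polynomial.natDegree_sum_le_of_forall_le _ _ fun z hz => ?_
      rw [map_smul, hθ]
      rcases hzero z hz with h0 | h0
      · simp [h0]
      · exact (Polynomial.natDegree_smul_le _ _).trans
          ((Polynomial.natDegree_prodForm_line (he z hz) _ _ _).trans h0)
  have hcoeff := congrArg (fun Q => Polynomial.coeff Q D₀) hQ
  simp only [map_sum, map_smul, hθ, Polynomial.finsetSum_coeff, Polynomial.coeff_smul,
    Polynomial.coeff_zero] at hcoeff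
  -- In the coefficient of `X ^ D₀` the forms of smaller degree drop out.
  have h1 : ∑ z ∈ s with D z = D₀, c z • ∏ j, Polynomial.aeval (w j) (h z j) = 0 := by
    rw [← hcoeff, Finset.sum_filter]
    refine Finset.sum_congr rfl fun z hz => ?_
    split_ifs with hD'
    · rw [← hD', Polynomial.coeff_prodForm_line (he z hz) _ (hh z hz)]
    · rcases hzero z hz with h0 | h0
      · simp [h0]
      · rw [Polynomial.coeff_eq_zero_of_natDegree_lt, smul_zero]
        exact (Polynomial.natDegree_prodForm_line (he z hz) _ _ _).trans_lt
          (lt_of_le_of_ne h0 hD')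
  have h2 : ∀ z j, Polynomial.aeval (w j) (h z j) = π (Polynomial.aeval (MvPolynomial.X j)
      (Polynomial.taylor (v j) (h z j))) := by
    intro z j
    rw [Polynomial.taylor_apply, Polynomial.aeval_comp, ← Polynomial.aeval_algHom_apply]
    congr 1
    simp [w, add_comm]
  simp only [h2, ← map_prod, ← map_smul, ← map_sum] at h1
  have h3 := Ideal.Quotient.eq_zero_iff_mem.1 h1
  rw [MvPolynomial.mem_pow_idealOfVars_iff'] at h3
  have h4 := h3 (Finsupp.equivFunOnFinite.symm i) ?_
  · simpa [MvPolynomial.coeff_sum, MvPolynomial.coeff_smul, MvPolynomial.coeff_prod_aeval_X]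
      using h4
  · rw [Finsupp.degree_eq_sum]
    simp only [Finsupp.equivFunOnFinite_symm_apply_apply]
    calc ∑ j, i j < ∑ _j : Fin n, m :=
          Finset.sum_lt_sum_of_nonempty ⟨⟨0, hn⟩, Finset.mem_univ _⟩ fun j _ => hi j
      _ = n * m := by simp

/-! ### The Kakeya maximal inequality -/

/-- Integer form of the Kakeya maximal inequality over a finite field. -/
theorem kakeya_nat {F : Type*} [Field F] [Fintype F] [DecidableEq F] {n : ℕ} (hn : 1 ≤ n)
    (f : (Fin n → F) × F → ℕ) (y : (Fin n → F) → Fin n → F) :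
    ∑ v : Fin n → F, ∑ D ∈ Finset.range ((∑ τ, f (y v + τ • v, τ) + 1) / 2),
      (D / (n * Fintype.card F)) ^ n ≤ ∑ x, f x ^ (n + 1) := by
  classical
  choose H hHdeg hH using fun m => exists_hermite_basis F m
  let q := Fintype.card F
  -- Unknowns: a direction `v`, a degree `D`, and a jet index in a box of side `D / (n * q)`. This
  -- side is the largest for which the interpolants of degree below `m * q` fit into a form of
  -- degree `D`.
  let Z : Finset (Σ _ : Fin n → F, Σ _ : ℕ, (Fin n → ℕ)) :=
    Finset.univ.sigma fun v => (Finset.range ((∑ τ, f (y v + τ • v, τ) + 1) / 2)).sigma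
      fun D => Fintype.piFinset fun _ => Finset.range (D / (n * q))
  -- Conditions: the `f x ^ (n + 1)` jets at each point `x`.
  let Y : Finset (Σ _ : (Fin n → F) × F, (Option (Fin n) → ℕ)) :=
    Finset.univ.sigma fun x => Fintype.piFinset fun _ => Finset.range (f x)
  let m : (Σ _ : Fin n → F, Σ _ : ℕ, (Fin n → ℕ)) → ℕ := fun z => z.2.1 / (n * q)
  let e : (Σ _ : Fin n → F, Σ _ : ℕ, (Fin n → ℕ)) → ℕ := fun z => m z * q - 1
  let h : (Σ _ : Fin n → F, Σ _ : ℕ, (Fin n → ℕ)) → Fin n → Polynomial F :=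
    fun z j => H (m z) (z.1 j) (z.2.2 j)
  let P : (Σ _ : Fin n → F, Σ _ : ℕ, (Fin n → ℕ)) → MvPolynomial (Option (Fin n)) F :=
    fun z => mvProdForm z.2.1 (e z) (h z)
  let jet : (x : (Fin n → F) × F) → (Option (Fin n) →₀ ℕ) →
      MvPolynomial (Option (Fin n)) F →ₗ[F] F := fun x β =>
    (MvPolynomial.lcoeff F β) ∘ₗ (MvPolynomial.aeval (fun o : Option (Fin n) =>
        (MvPolynomial.X o + MvPolynomial.C (o.elim x.2 x.1) :
          MvPolynomial (Option (Fin n)) F))).toLinearMap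
  let Φ : (Z → F) →ₗ[F] (Y → F) := LinearMap.pi fun b =>
    jet b.1.1 (Finsupp.equivFunOnFinite.symm b.1.2) ∘ₗ
      Fintype.linearCombination F (fun z : Z => P z)
  have hinj : Function.Injective Φ := by
    rw [← LinearMap.ker_eq_bot, LinearMap.ker_eq_bot']
    intro c hc
    by_contra hne
    have hne' : (Finset.univ.filter fun z : Z => c z ≠ 0).Nonempty := by
      obtain ⟨z, hz⟩ := Function.ne_iff.1 hne
      exact ⟨z, by simpa using hz⟩
    -- Among the nonzero coefficients one of largest degree is taken. The line in its direction
    -- isolates the forms of that degree, and the dual basis property singles out `z₀` among them.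
    obtain ⟨z₀, hz₀, hmax⟩ := Finset.exists_max_image _ (fun z : Z => z.1.2.1) hne'
    have hz₀c : c z₀ ≠ 0 := by simpa using hz₀
    have hz₀Z := z₀.2
    simp only [Z, Finset.mem_sigma, Finset.mem_univ, true_and, Finset.mem_range,
      Fintype.mem_piFinset] at hz₀Z
    have hm0 : n * m z₀ * q ≤ z₀.1.2.1 := by
      have := Nat.mul_div_le z₀.1.2.1 (n * q)
      simp only [m]
      nlinarith
    have key := coeff_taylor_eq_zero_of_line hn
      (fun τ => f (y z₀.1.1 + τ • z₀.1.1, τ)) (y z₀.1.1) z₀.1.1 Finset.univ c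
      (fun z : Z => z.1.2.1) (fun z => e z) (fun z => h z) (fun z _ j => hHdeg _ _ _)
      (fun z _ => ?_) z₀.1.2.1 (m z₀)
      (fun z _ hz => hmax z (by simpa using hz)) ?_ ?_ z₀.1.2.2 hz₀Z.2
    · rw [Finset.sum_eq_single z₀] at key
      · refine hz₀c ?_
        rw [Finset.prod_eq_one, mul_one] at key
        · exact key
        · intro j _
          rw [hH _ _ _ (hz₀Z.2 j) _ _ (hz₀Z.2 j)]
          simp
      · intro z hz hzne
        have hzD : z.1.2.1 = z₀.1.2.1 := by simpa using hz
        have hzZ := z.2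
        simp only [Z, Finset.mem_sigma, Finset.mem_univ, true_and, Finset.mem_range,
          Fintype.mem_piFinset] at hzZ
        have hmz : m z = m z₀ := by simp only [m, hzD]
        obtain ⟨j, hj⟩ : ∃ j, ¬ (z₀.1.1 j = z.1.1 j ∧ z₀.1.2.2 j = z.1.2.2 j) := by
          by_contra! hall
          refine hzne (Subtype.ext ?_)
          obtain ⟨⟨a, b, d⟩, _⟩ := z
          obtain ⟨⟨a', b', d'⟩, _⟩ := z₀
          simp only at hall hzD
          obtain rfl : a' = a := funext fun j => (hall j).1
          obtain rfl : d' = d := funext fun j => (hall j).2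
          subst hzD
          rfl
        rw [Finset.prod_eq_zero (Finset.mem_univ j), mul_zero]
        simp only [h]
        rw [hH _ _ _ (hzZ.2 j) _ _ (by rw [hzD]; exact hz₀Z.2 j), if_neg hj]
      · intro hnot
        exact absurd (by simp) hnot
    · have := Nat.mul_div_le z.1.2.1 (n * q)
      have h2 : n * e z ≤ n * (m z * q) := Nat.mul_le_mul_left _ (Nat.sub_le _ _)
      simp only [m] at h2
      nlinarith
    · intro τ β hβ
      have := congrFun hc ⟨⟨(y z₀.1.1 + τ • z₀.1.1, τ), β⟩, by
        simpa [Y] using hβ⟩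
      simpa [Φ, jet, P, Fintype.linearCombination_apply, MvPolynomial.coeff_sum] using this
    -- Here `n * m * q ≤ D`, and the range of `D` gives `2 * D < l`, where `l` is the sum of `f` on
    -- the line.
    · have := hz₀Z.1
      change z₀.1.2.1 + n * m z₀ * q < _
      omega
  have hcard := LinearMap.finrank_le_finrank_of_injective hinj
  simp only [Module.finrank_fintype_fun_eq_card, Fintype.card_coe] at hcard
  simpa [Z, Y, Finset.card_sigma, Fintype.card_piFinset] using hcard

/-- With `N = n * q` and `j = l / (4 * N)`, the `N * j` degrees in `[N j, 2 N j)` lie below `l / 2`,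
and each contributes at least `j ^ n`. This is the origin of the factor 4. -/
theorem kakeya_nat_div {F : Type*} [Field F] [Fintype F] {n : ℕ} (hn : 1 ≤ n)
    (f : (Fin n → F) × F → ℕ) (y : (Fin n → F) → Fin n → F) :
    n * Fintype.card F * ∑ v : Fin n → F,
      ((∑ τ, f (y v + τ • v, τ)) / (4 * (n * Fintype.card F))) ^ (n + 1) ≤
        ∑ x, f x ^ (n + 1) := by
  classical
  refine le_trans ?_ (kakeya_nat hn f y)
  rw [Finset.mul_sum]
  refine Finset.sum_le_sum fun v _ => ?_
  set N := n * Fintype.card F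
  set l := ∑ τ, f (y v + τ • v, τ)
  set j := l / (4 * N)
  have hN : 0 < N := Nat.mul_pos hn Fintype.card_pos
  have hj : 4 * N * j ≤ l := Nat.mul_div_le _ _
  have hj' : 2 * (2 * (N * j)) ≤ l := by
    rw [← mul_assoc, ← mul_assoc]
    exact hj
  calc N * j ^ (n + 1) = ∑ _D ∈ Finset.Ico (N * j) (2 * (N * j)), j ^ n := by
        rw [Finset.sum_const, Nat.card_Ico, smul_eq_mul, two_mul, Nat.add_sub_cancel]
        ring
    _ ≤ ∑ D ∈ Finset.Ico (N * j) (2 * (N * j)), (D / N) ^ n := by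
        refine Finset.sum_le_sum fun D hD => Nat.pow_le_pow_left ?_ _
        rw [Nat.le_div_iff_mul_le hN, mul_comm]
        exact (Finset.mem_Ico.1 hD).1
    _ ≤ _ := by
        refine Finset.sum_le_sum_of_subset fun D hD => ?_
        rw [Finset.mem_range]
        have := (Finset.mem_Ico.1 hD).2
        omega

/-- The Kakeya maximal inequality over a finite field. -/
theorem kakeya_maximal {F : Type*} [Field F] [Fintype F] {n : ℕ} (hn : 1 ≤ n)
    (g : (Fin n → F) × F → ℝ) (hg : ∀ x, 0 ≤ g x) (y : (Fin n → F) → Fin n → F) :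
    ∑ v : Fin n → F, (∑ τ, g (y v + τ • v, τ)) ^ (n + 1) ≤
      (4 ^ (n + 1) * (n : ℝ) ^ n) * (Fintype.card F : ℝ) ^ n * ∑ x, g x ^ (n + 1) := by
  have hq : (0 : ℝ) < Fintype.card F := by exact_mod_cast Fintype.card_pos
  have hn0 : (0 : ℝ) < n := by exact_mod_cast hn
  set N : ℝ := n * Fintype.card F with hN
  have hN0 : 0 < N := mul_pos hn0 hq
  set L : (Fin n → F) → ℝ := fun v => ∑ τ, g (y v + τ • v, τ)
  have hL : ∀ v, 0 ≤ L v := fun v => Finset.sum_nonneg fun _ _ => hg _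
  -- The integer inequality is applied to `g` scaled by `M = k + 1` and rounded up. The rounding
  -- errors become `1 / M` after rescaling and vanish as `k → ∞`.
  have key : ∀ k : ℕ, N * ∑ v, (max 0 (L v / (4 * N) - 1 / ((k : ℝ) + 1))) ^ (n + 1) ≤
      ∑ x, (g x + 1 / ((k : ℝ) + 1)) ^ (n + 1) := by
    intro k
    set M : ℝ := (k : ℝ) + 1
    have hM : 0 < M := by positivity
    have h := kakeya_nat_div hn (fun x => ⌈M * g x⌉₊) y
    have h' : N * ∑ v : Fin n → F, ((((∑ τ, ⌈M * g (y v + τ • v, τ)⌉₊) /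
        (4 * (n * Fintype.card F)) : ℕ) : ℝ)) ^ (n + 1) ≤ ∑ x, ((⌈M * g x⌉₊ : ℕ) : ℝ) ^ (n + 1) := by
      rw [hN]
      exact_mod_cast h
    have hMp : 0 < M ^ (n + 1) := by positivity
    refine le_of_mul_le_mul_left ?_ hMp
    calc M ^ (n + 1) * (N * ∑ v, (max 0 (L v / (4 * N) - 1 / M)) ^ (n + 1))
        = N * ∑ v, (M * max 0 (L v / (4 * N) - 1 / M)) ^ (n + 1) := by
          simp only [mul_pow, ← Finset.mul_sum]; ring
      _ ≤ _ := ?_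
      _ ≤ _ := h'
      _ ≤ ∑ x, (M * (g x + 1 / M)) ^ (n + 1) := ?_
      _ = _ := by simp only [mul_pow, ← Finset.mul_sum]
    · refine mul_le_mul_of_nonneg_left (Finset.sum_le_sum fun v _ => ?_) hN0.le
      refine pow_le_pow_left₀ (by positivity) ?_ _
      rw [mul_max_of_nonneg _ _ hM.le, mul_zero]
      refine max_le (Nat.cast_nonneg _) ?_
      have h1 : M * L v ≤ ((∑ τ, ⌈M * g (y v + τ • v, τ)⌉₊ : ℕ) : ℝ) := by
        push_cast
        rw [Finset.mul_sum]
        exact Finset.sum_le_sum fun τ _ => Nat.le_ceil _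
      set l := ∑ τ, ⌈M * g (y v + τ • v, τ)⌉₊
      have hpos : 0 < 4 * (n * Fintype.card F) :=
        Nat.mul_pos (by norm_num) (Nat.mul_pos hn Fintype.card_pos)
      have h2 : (l : ℝ) ≤ 4 * N * ((l / (4 * (n * Fintype.card F)) : ℕ) + 1 : ℝ) := by
        rw [hN]
        exact_mod_cast (Nat.lt_mul_div_succ l hpos).le
      have h3 : M * L v / (4 * N) ≤ ((l / (4 * (n * Fintype.card F)) : ℕ) + 1 : ℝ) := by
        rw [div_le_iff₀' (by positivity)]
        exact h1.trans h2
      have h4 : M * (L v / (4 * N) - 1 / M) = M * L v / (4 * N) - 1 := by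
        field_simp
      linarith
    · refine Finset.sum_le_sum fun x _ => pow_le_pow_left₀ (by positivity) ?_ _
      have h4 : M * (g x + 1 / M) = M * g x + 1 := by field_simp
      rw [h4]
      exact (Nat.ceil_lt_add_one (mul_nonneg hM.le (hg x))).le
  have lim := tendsto_one_div_add_atTop_nhds_zero_nat (𝕜 := ℝ)
  have hl : Filter.Tendsto
      (fun k : ℕ => N * ∑ v, (max 0 (L v / (4 * N) - 1 / ((k : ℝ) + 1))) ^ (n + 1))
      Filter.atTop (nhds (N * ∑ v, (max 0 (L v / (4 * N) - 0)) ^ (n + 1))) := by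
    have hc : Continuous fun ε : ℝ => N * ∑ v, (max 0 (L v / (4 * N) - ε)) ^ (n + 1) := by fun_prop
    exact (hc.tendsto 0).comp lim
  have hr : Filter.Tendsto (fun k : ℕ => ∑ x, (g x + 1 / ((k : ℝ) + 1)) ^ (n + 1))
      Filter.atTop (nhds (∑ x, (g x + 0) ^ (n + 1))) := by
    have hc : Continuous fun ε : ℝ => ∑ x, (g x + ε) ^ (n + 1) := by fun_prop
    exact (hc.tendsto 0).comp lim
  have h := le_of_tendsto_of_tendsto' hl hr key
  have hmax : ∀ v, max 0 (L v / (4 * N) - 0) = L v / (4 * N) := fun v => by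
    rw [sub_zero]
    exact max_eq_right (by have := hL v; positivity)
  simp only [hmax, add_zero, div_pow, ← Finset.sum_div] at h
  calc ∑ v, L v ^ (n + 1) = (4 ^ (n + 1) * (n : ℝ) ^ n) * (Fintype.card F : ℝ) ^ n *
        (N * ((∑ v, L v ^ (n + 1)) / (4 * N) ^ (n + 1))) := by
        rw [hN]; field_simp; ring
    _ ≤ _ := mul_le_mul_of_nonneg_left h (by positivity)

theorem kakeya_maximal_module {F V : Type*} [Field F] [Fintype F] [AddCommGroup V] [Module F V]
    [Fintype V] {n : ℕ} (hn : 1 ≤ n) (hV : Module.finrank F V = n) (c : F) (hc : c ≠ 0)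
    (g : V × F → ℝ) (hg : ∀ x, 0 ≤ g x) (y : V → V) :
    ∑ v, (∑ τ, g (y v + τ • c • v, τ)) ^ (n + 1) ≤
      (4 ^ (n + 1) * (n : ℝ) ^ n) * (Fintype.card F : ℝ) ^ n * ∑ x, g x ^ (n + 1) := by
  let φ : V ≃ₗ[F] (Fin n → F) := LinearEquiv.ofFinrankEq V (Fin n → F) (by simp [hV])
  -- Directions are reparametrized so that `v` labels the direction `c • v`.
  let ψ : V ≃ₗ[F] (Fin n → F) := (LinearEquiv.smulOfNeZero F V c hc).trans φ
  have h := kakeya_maximal hn (fun x : (Fin n → F) × F => g (φ.symm x.1, x.2)) (fun _ => hg _)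
    (fun u => φ (y (ψ.symm u)))
  rw [← ψ.toEquiv.sum_comp] at h
  have h2 : ∑ x : (Fin n → F) × F, g (φ.symm x.1, x.2) ^ (n + 1) = ∑ x, g x ^ (n + 1) :=
    (φ.symm.toEquiv.prodCongr (Equiv.refl F)).sum_comp (fun x => g x ^ (n + 1))
  rw [h2] at h
  refine le_of_eq_of_le (Finset.sum_congr rfl fun v _ => ?_) h
  congr 1
  refine Finset.sum_congr rfl fun τ _ => ?_
  have h3 : ψ.symm (ψ v) = v := ψ.symm_apply_apply v
  change _ = g (φ.symm (φ (y (ψ.symm (ψ v))) + τ • φ (c • v)), τ)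
  rw [h3, map_add, map_smul]
  simp

/-! ### Duality: superpositions of lines -/

/-- The dual form of the Kakeya maximal inequality: an estimate for superpositions of lines. -/
theorem sum_rpow_le_of_lines {F V : Type*} [Field F] [Fintype F] [AddCommGroup V] [Module F V]
    [Fintype V] {n : ℕ} (hn : 1 ≤ n) (hV : Module.finrank F V = n) (c : F) (hc : c ≠ 0)
    (h : V → V → ℝ) (hh : ∀ v y, 0 ≤ h v y) :
    ∑ y, ∑ t : F, (∑ v, h v (y + (t * c) • v)) ^ (((n : ℝ) + 1) / n) ≤
      (4 ^ (n + 1) * (n : ℝ) ^ n) ^ (1 / (n : ℝ)) * Fintype.card F *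
        ∑ v, (∑ y, h v y) ^ (((n : ℝ) + 1) / n) := by
  have hn0 : (0 : ℝ) < n := by exact_mod_cast hn
  have hq : (0 : ℝ) < Fintype.card F := by exact_mod_cast Fintype.card_pos
  set C : ℝ := 4 ^ (n + 1) * (n : ℝ) ^ n with hC
  have hC0 : 0 < C := by positivity
  set r : ℝ := ((n : ℝ) + 1) / n with hr
  have hr0 : 0 < r := by positivity
  set G : V → F → ℝ := fun y t => ∑ v, h v (y + (t * c) • v) with hG
  have hG0 : ∀ y t, 0 ≤ G y t := fun y t => Finset.sum_nonneg fun _ _ => hh _ _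
  set X : ℝ := ∑ y, ∑ t, G y t ^ r with hX
  set a : V → ℝ := fun v => ∑ y, h v y
  have ha0 : ∀ v, 0 ≤ a v := fun v => Finset.sum_nonneg fun _ _ => hh _ _
  set S : ℝ := ∑ v, a v ^ r
  have hS0 : 0 ≤ S := Finset.sum_nonneg fun v _ => Real.rpow_nonneg (ha0 v) _
  have hX0 : 0 ≤ X :=
    Finset.sum_nonneg fun y _ => Finset.sum_nonneg fun t _ => Real.rpow_nonneg (hG0 y t) _
  -- The extremal dual function: `G ^ r = G * g` and `g ^ (n + 1) = G ^ r`.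
  let g : V × F → ℝ := fun x => G x.1 x.2 ^ (1 / (n : ℝ))
  have hg0 : ∀ x, 0 ≤ g x := fun x => Real.rpow_nonneg (hG0 _ _) _
  have hgG : ∀ y t, G y t ^ r = G y t * g (y, t) := by
    intro y t
    have : r = 1 + 1 / n := by rw [hr]; field_simp
    rw [this, Real.rpow_add_of_nonneg (hG0 y t) zero_le_one (by positivity), Real.rpow_one]
  have hgpow : ∑ x, g x ^ (n + 1) = X := by
    rw [Fintype.sum_prod_type]
    refine Finset.sum_congr rfl fun y _ => Finset.sum_congr rfl fun t _ => ?_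
    rw [← Real.rpow_natCast, ← Real.rpow_mul (hG0 y t)]
    congr 1
    rw [hr]; push_cast; field_simp
  -- Translating `y` weights `h v` by sums of `g` over lines of direction `-c • v`; the worst base
  -- point is chosen for each `v`.
  have hmax : ∀ v : V, ∃ y₀, ∀ y, ∑ t, g (y + t • (-c) • v, t) ≤ ∑ t, g (y₀ + t • (-c) • v, t) :=
    fun v => Finite.exists_max fun y => ∑ t, g (y + t • (-c) • v, t)
  choose y₀ hy₀ using hmax
  set L : V → ℝ := fun v => ∑ t, g (y₀ v + t • (-c) • v, t)
  have hL0 : ∀ v, 0 ≤ L v := fun v => Finset.sum_nonneg fun _ _ => hg0 _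
  have hkak : ∑ v, L v ^ (n + 1) ≤ C * (Fintype.card F : ℝ) ^ n * X := by
    rw [← hgpow]
    exact kakeya_maximal_module hn hV (-c) (neg_ne_zero.2 hc) g hg0 y₀
  have hX1 : X ≤ ∑ v, a v * L v := by
    calc X = ∑ t : F, ∑ v, ∑ y, h v (y + (t * c) • v) * g (y, t) := by
          rw [hX, Finset.sum_comm]
          refine Finset.sum_congr rfl fun t _ => ?_
          rw [Finset.sum_comm]
          refine Finset.sum_congr rfl fun y _ => ?_
          rw [hgG, hG, Finset.sum_mul]
      _ = ∑ t : F, ∑ v, ∑ y, h v y * g (y + t • (-c) • v, t) := by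
          refine Finset.sum_congr rfl fun t _ => Finset.sum_congr rfl fun v _ => ?_
          rw [← Equiv.sum_comp (Equiv.addRight ((t * c) • v)) (fun y => h v y * g (y + t • (-c) • v, t))]
          refine Finset.sum_congr rfl fun y _ => ?_
          simp [mul_smul]
      _ = ∑ v, ∑ y, h v y * ∑ t, g (y + t • (-c) • v, t) := by
          rw [Finset.sum_comm]
          refine Finset.sum_congr rfl fun v _ => ?_
          rw [Finset.sum_comm]
          simp only [Finset.mul_sum]
      _ ≤ ∑ v, ∑ y, h v y * L v :=
          Finset.sum_le_sum fun v _ => Finset.sum_le_sum fun y _ =>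
            mul_le_mul_of_nonneg_left (hy₀ v y) (hh v y)
      _ = _ := by simp only [a, Finset.sum_mul]
  have hconj : r.HolderConjugate ((n : ℝ) + 1) := by
    rw [Real.holderConjugate_iff]
    refine ⟨?_, ?_⟩
    · rw [hr, lt_div_iff₀ hn0]; linarith
    · rw [hr]; field_simp
  have hX2 : X ≤ S ^ (1 / r) * (∑ v, L v ^ (n + 1)) ^ (1 / ((n : ℝ) + 1)) := by
    refine hX1.trans ?_
    have := Real.inner_le_Lp_mul_Lq_of_nonneg Finset.univ hconj (f := a) (g := L)
      (fun v _ => ha0 v) (fun v _ => hL0 v)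
    refine this.trans (le_of_eq ?_)
    congr 2
    refine Finset.sum_congr rfl fun v _ => ?_
    rw [← Real.rpow_natCast]; push_cast; rfl
  have hLs : 0 ≤ ∑ v, L v ^ (n + 1) := Finset.sum_nonneg fun v _ => pow_nonneg (hL0 v) _
  -- `X` reappears on the right to the first power; cancelling it and taking an `n`-th root gives
  -- the bound.
  have hX3 : X ^ (n + 1) ≤ S ^ n * (C * (Fintype.card F : ℝ) ^ n * X) := by
    calc X ^ (n + 1) ≤ (S ^ (1 / r) * (∑ v, L v ^ (n + 1)) ^ (1 / ((n : ℝ) + 1))) ^ (n + 1) :=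
          pow_le_pow_left₀ hX0 hX2 _
      _ = S ^ n * ∑ v, L v ^ (n + 1) := by
          rw [mul_pow, ← Real.rpow_natCast (S ^ (1 / r)), ← Real.rpow_mul hS0,
            ← Real.rpow_natCast ((∑ v, L v ^ (n + 1)) ^ (1 / ((n : ℝ) + 1))),
            ← Real.rpow_mul hLs, ← Real.rpow_natCast S n]
          push_cast
          rw [one_div_mul_cancel (by positivity), Real.rpow_one]
          congr 2
          rw [hr]; field_simp
      _ ≤ _ := mul_le_mul_of_nonneg_left hkak (by positivity)
  rcases hX0.eq_or_lt with h0 | h0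
  · rw [← h0]; positivity
  · have hX4 : X ^ n ≤ (C ^ (1 / (n : ℝ)) * Fintype.card F * S) ^ n := by
      rw [mul_pow, mul_pow, ← Real.rpow_natCast (C ^ (1 / (n : ℝ))), ← Real.rpow_mul hC0.le,
        one_div_mul_cancel hn0.ne', Real.rpow_one]
      refine le_of_mul_le_mul_right ?_ h0
      calc X ^ n * X = X ^ (n + 1) := (pow_succ _ _).symm
        _ ≤ _ := hX3
        _ = _ := by ring
    exact le_of_pow_le_pow_left₀ (by omega) (by positivity) hX4

/-! ### Character sums and isotropic subspaces -/

theorem AddChar.sum_comp_linear {F Y : Type*} [Field F] [AddCommGroup Y] [Module F Y]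
    [Fintype Y] (e : AddChar F ℂ) (he : e ≠ 1) (l : Y →ₗ[F] F) (hl : l ≠ 0) :
    ∑ y, e (l y) = 0 := by
  have hne : e.compAddMonoidHom l.toAddMonoidHom ≠ 0 := by
    intro h
    refine he (DFunLike.ext _ _ fun x => ?_)
    obtain ⟨y, rfl⟩ := LinearMap.surjective hl x
    exact DFunLike.congr_fun h y
  exact AddChar.sum_eq_zero_iff_ne_zero.2 hne

/-- Plancherel by orthogonality of characters. Nondegeneracy on the side of `X` suffices, since it
only has to make distinct `x` give distinct characters of `Y`. -/
theorem sum_norm_sq_char_sum {F X Y : Type*} [Field F] [Fintype F] [AddCommGroup X] [Module F X]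
    [Fintype X] [AddCommGroup Y] [Module F Y] [Fintype Y] (e : AddChar F ℂ) (he : e ≠ 1)
    (B : X →ₗ[F] Y →ₗ[F] F) (hB : ∀ x, (∀ y, B x y = 0) → x = 0) (c : X → ℂ) :
    ∑ y, ‖∑ x, c x * e (B x y)‖ ^ 2 = Fintype.card Y * ∑ x, ‖c x‖ ^ 2 := by
  classical
  have horth : ∀ x x', ∑ y, e (B x y) * starRingEnd ℂ (e (B x' y)) =
      if x = x' then (Fintype.card Y : ℂ) else 0 := by
    intro x x'
    have h1 : ∀ y, e (B x y) * starRingEnd ℂ (e (B x' y)) = e (B (x - x') y) := fun y => by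
      rw [← AddChar.map_neg_eq_conj, ← AddChar.map_add_eq_mul]
      simp [sub_eq_add_neg]
    simp only [h1]
    split_ifs with h
    · simp [h]
    · refine AddChar.sum_comp_linear e he _ fun h0 => h (sub_eq_zero.1 (hB _ fun y => ?_))
      rw [h0]; rfl
  have hnorm : ∀ z : ℂ, ((‖z‖ ^ 2 : ℝ) : ℂ) = z * starRingEnd ℂ z := fun z => by
    rw [Complex.mul_conj, Complex.normSq_eq_norm_sq]
  rw [← Complex.ofReal_inj]
  push_cast
  simp only [← Complex.ofReal_pow, hnorm]
  calc ∑ y, (∑ x, c x * e (B x y)) * starRingEnd ℂ (∑ x, c x * e (B x y))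
      = ∑ x, ∑ x', c x * starRingEnd ℂ (c x') * ∑ y, e (B x y) * starRingEnd ℂ (e (B x' y)) := by
        simp only [map_sum, Finset.sum_mul_sum]
        rw [Finset.sum_comm]
        refine Finset.sum_congr rfl fun x _ => ?_
        rw [Finset.sum_comm]
        refine Finset.sum_congr rfl fun x' _ => ?_
        rw [Finset.mul_sum]
        refine Finset.sum_congr rfl fun y _ => ?_
        rw [map_mul]
        ring
    _ = _ := by
        simp only [horth, mul_ite, mul_zero, Finset.sum_ite_eq, Finset.mem_univ, if_true,
          Finset.mul_sum]
        exact Finset.sum_congr rfl fun x _ => by ring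

section forms
variable {F : Type*} [Field F] {m : ℕ}

/-- The form `formOf A` as a bilinear map. -/
noncomputable def formBilin (A : Matrix (Fin m) (Fin m) F) :
    (Fin m → F) →ₗ[F] (Fin m → F) →ₗ[F] F := Matrix.toBilin' A

theorem formBilin_apply (A : Matrix (Fin m) (Fin m) F) (x y : Fin m → F) :
    formBilin A x y = formOf A x y := Matrix.toBilin'_apply' A x y

theorem formOf_comm {A : Matrix (Fin m) (Fin m) F} (hA : A.IsSymm) (x y : Fin m → F) :
    formOf A x y = formOf A y x := by
  rw [formOf, formOf, Matrix.dotProduct_mulVec, dotProduct_comm, ← Matrix.mulVec_transpose, hA.eq]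

theorem TotallyIsotropic.formOf_eq_zero {A : Matrix (Fin m) (Fin m) F} (hA : A.IsSymm)
    (h2 : (2 : F) ≠ 0) {U : Submodule F (Fin m → F)} (hU : TotallyIsotropic A U)
    {x y : Fin m → F} (hx : x ∈ U) (hy : y ∈ U) : formOf A x y = 0 := by
  have h := hU _ (U.add_mem hx hy)
  have hx' := hU x hx
  have hy' := hU y hy
  have hc := formOf_comm hA x y
  simp only [← formBilin_apply, map_add, LinearMap.add_apply] at *
  rw [hx', hy', ← hc, zero_add, add_zero, ← two_mul] at h
  exact (mul_eq_zero.1 h).resolve_left h2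

/-- Such a `v` is orthogonal to `W` by assumption and to `V` by isotropy, hence to everything. So
the form puts `W` and `V` in duality, which is what Plancherel needs. -/
theorem TotallyIsotropic.eq_zero_of_forall {A : Matrix (Fin m) (Fin m) F} (hA : A.IsSymm)
    (hdet : IsUnit A.det) (h2 : (2 : F) ≠ 0) {W V : Submodule F (Fin m → F)}
    (hV : TotallyIsotropic A V) (hWV : IsCompl W V) {v : Fin m → F} (hv : v ∈ V)
    (h : ∀ w ∈ W, formOf A v w = 0) : v = 0 := by
  have h0 : ∀ x, x ⬝ᵥ (A *ᵥ v) = 0 := by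
    intro x
    change formOf A x v = 0
    rw [formOf_comm hA]
    obtain ⟨w, hw, u, hu, rfl⟩ := Submodule.mem_sup.1
      (hWV.sup_eq_top ▸ Submodule.mem_top : x ∈ W ⊔ V)
    have h1 := h w hw
    have h3 := hV.formOf_eq_zero hA h2 hv hu
    simp only [← formBilin_apply, map_add] at *
    rw [h1, h3, add_zero]
  have h1 : A *ᵥ v = 0 := dotProduct_eq_zero _ fun x => by rw [dotProduct_comm]; exact h0 x
  have := Matrix.mulVec_injective_of_isUnit ((Matrix.isUnit_iff_isUnit_det A).2 hdet)
  exact this (by simpa using h1)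

end forms

open Classical in
theorem sum_eq_sum_sum_of_isCompl {F E M : Type*} [Field F] [Fintype F] [AddCommGroup E]
    [Module F E] [Fintype E] [AddCommMonoid M] {W V : Submodule F E} (h : IsCompl W V)
    (φ : E → M) : ∑ x, φ x = ∑ v : V, ∑ w : W, φ (w + v) := by
  rw [← (Submodule.prodEquivOfIsCompl W V h).toEquiv.sum_comp φ, Fintype.sum_prod_type,
    Finset.sum_comm]
  rfl

theorem card_eq_pow_of_finrank {F E : Type*} [Field F] [Fintype F] [AddCommGroup E] [Module F E]
    [Module.Finite F E] [Fintype E] {n : ℕ} (h : Module.finrank F E = n) :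
    Fintype.card E = Fintype.card F ^ n := by
  rw [Module.card_eq_pow_finrank (K := F), h]

/-! ### The extension estimate -/

section extension
variable {F : Type*} [Field F] [Fintype F] {n : ℕ}

-- Plancherel in `w'` against the characters indexed by `v`; the factor is `(q ^ (-2n)) ^ 2 * q ^
-- n`.
open Classical in
theorem sum_norm_sq_extension (e : AddChar F ℂ) (he : e ≠ 1) (h2 : (2 : F) ≠ 0)
    (A : Matrix (Fin (2 * n)) (Fin (2 * n)) F) (hA : A.IsSymm) (hdet : IsUnit A.det)
    (W V : Submodule F (Fin (2 * n) → F)) (hWn : Module.finrank F W = n)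
    (hW : TotallyIsotropic A W) (hV : TotallyIsotropic A V) (hWV : IsCompl W V)
    (f : (Fin (2 * n) → F) → ℂ) (v' : V) (t : F) :
    ∑ w' : W, ‖extension e A f ((w' : Fin (2 * n) → F) + (v' : Fin (2 * n) → F), t)‖ ^ 2 =
      ((Fintype.card F : ℝ) ^ (3 * n))⁻¹ * ∑ v : V,
        ‖∑ w : W, f (w + v) * e (formOf A w (v' + (t * 2) • v : V))‖ ^ 2 := by
  have hq : (Fintype.card F : ℝ) ≠ 0 := by exact_mod_cast Fintype.card_ne_zero
  -- Of the phase only `w ∘ v'`, `v ∘ w'` and the doubled cross term `2 t (w ∘ v)` survive.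
  have key : ∀ w' : W, extension e A f ((w' : Fin (2 * n) → F) + (v' : Fin (2 * n) → F), t) =
      ((Fintype.card F : ℂ) ^ (2 * n))⁻¹ * ∑ v : V,
        (∑ w : W, f (w + v) * e (formOf A w (v' + (t * 2) • v : V))) *
          e (((formBilin A).domRestrict₁₂ V W) v w') := by
    intro w'
    rw [extension, sum_eq_sum_sum_of_isCompl hWV]
    congr 1
    refine Finset.sum_congr rfl fun v _ => ?_
    rw [Finset.sum_mul]
    refine Finset.sum_congr rfl fun w _ => ?_
    rw [mul_assoc, ← AddChar.map_add_eq_mul]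
    congr 2
    have h1 := hW.formOf_eq_zero hA h2 w.2 w'.2
    have h3 := hV.formOf_eq_zero hA h2 v.2 v'.2
    have h4 := hW w w.2
    have h5 := hV v v.2
    have h6 := formOf_comm hA (v : Fin (2 * n) → F) w
    simp only [LinearMap.domRestrict₁₂_apply, Submodule.coe_add, Submodule.coe_smul,
      ← formBilin_apply, map_add, LinearMap.add_apply, map_smul, smul_eq_mul] at *
    rw [h1, h3, h4, h5, h6]
    ring
  simp only [key, norm_mul, mul_pow, ← Finset.mul_sum]
  rw [sum_norm_sq_char_sum e he _ (fun v hv => ?_), card_eq_pow_of_finrank hWn, ← mul_assoc]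
  · congr 1
    simp only [norm_inv, norm_pow, Complex.norm_natCast]
    push_cast
    field_simp
    ring
  · exact Subtype.ext (hV.eq_zero_of_forall hA hdet h2 hWV v.2 fun w hw => by
      have := hv ⟨w, hw⟩
      rwa [LinearMap.domRestrict₁₂_apply, formBilin_apply] at this)

open Classical in
theorem sum_norm_sq_fiber (e : AddChar F ℂ) (he : e ≠ 1) (h2 : (2 : F) ≠ 0)
    (A : Matrix (Fin (2 * n)) (Fin (2 * n)) F) (hA : A.IsSymm) (hdet : IsUnit A.det)
    (W V : Submodule F (Fin (2 * n) → F)) (hVn : Module.finrank F V = n)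
    (hW : TotallyIsotropic A W) (hWV : IsCompl W V)
    (f : (Fin (2 * n) → F) → ℂ) (v : V) :
    ∑ y : V, ‖∑ w : W, f (w + v) * e (formOf A w y)‖ ^ 2 =
      (Fintype.card F : ℝ) ^ n * ∑ w : W, ‖f (w + v)‖ ^ 2 := by
  have h := sum_norm_sq_char_sum e he ((formBilin A).domRestrict₁₂ W V) (fun w hw => ?_)
    (fun w => f (w + v))
  · rw [card_eq_pow_of_finrank hVn] at h
    push_cast at h
    rw [← h]
    simp only [LinearMap.domRestrict₁₂_apply, formBilin_apply]
  · exact Subtype.ext (hW.eq_zero_of_forall hA hdet h2 hWV.symm w.2 fun v hv => by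
      have := hw ⟨v, hv⟩
      rwa [LinearMap.domRestrict₁₂_apply, formBilin_apply] at this)

/-- The mixed norm extension estimate, with an explicit constant. -/
theorem extension_mixedNorm_le (hn : 1 ≤ n) (e : AddChar F ℂ) (he : e ≠ 1) (h2 : (2 : F) ≠ 0)
    (A : Matrix (Fin (2 * n)) (Fin (2 * n)) F) (hA : A.IsSymm) (hdet : IsUnit A.det)
    (W V : Submodule F (Fin (2 * n) → F)) (hWn : Module.finrank F W = n)
    (hVn : Module.finrank F V = n) (hW : TotallyIsotropic A W) (hV : TotallyIsotropic A V)
    (hWV : IsCompl W V) (f : (Fin (2 * n) → F) → ℂ) (s : ℝ) (hs : s / 2 = ((n : ℝ) + 1) / n) :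
    mixedNormSpace W V 2 s (extension e A f) ≤
      (((4 ^ (n + 1) * (n : ℝ) ^ n) ^ (1 / (n : ℝ))) ^ (1 / s)) * mixedNormSurface W V 2 s f := by
  classical
  have hn0 : (0 : ℝ) < n := by exact_mod_cast hn
  have hq : (0 : ℝ) < Fintype.card F := by exact_mod_cast Fintype.card_pos
  set q : ℝ := (Fintype.card F : ℝ) with hqdef
  set r : ℝ := ((n : ℝ) + 1) / n with hr
  have hr0 : 0 < r := by positivity
  have hs0 : 0 < s := by linarith
  set K : ℝ := (4 ^ (n + 1) * (n : ℝ) ^ n) ^ (1 / (n : ℝ)) with hK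
  have hK0 : 0 < K := by positivity
  have hqr : (q ^ n) ^ r = q ^ (n + 1) := by
    rw [← Real.rpow_natCast, ← Real.rpow_mul hq.le, ← Real.rpow_natCast]
    congr 1
    rw [hr]; push_cast; field_simp
  let h : V → V → ℝ := fun v y => ‖∑ w : W, f (w + v) * e (formOf A w y)‖ ^ 2
  have hh : ∀ v y, 0 ≤ h v y := fun v y => by positivity
  set a : V → ℝ := fun v => ∑ w : W, ‖f (w + v)‖ ^ 2 with ha
  have ha0 : ∀ v, 0 ≤ a v := fun v => by positivity
  have hha : ∀ v, ∑ y, h v y = q ^ n * a v := fun v =>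
    sum_norm_sq_fiber e he h2 A hA hdet W V hVn hW hWV f v
  have hlines := sum_rpow_le_of_lines hn hVn (2 : F) h2 h hh
  simp only [hha, ← hqdef, ← hr, ← hK] at hlines
  rw [mixedNormSpace, mixedNormSurface, ← Real.mul_rpow hK0.le (by positivity)]
  refine Real.rpow_le_rpow (by positivity) ?_ (by positivity)
  simp only [Real.rpow_two, hs]
  have hext := sum_norm_sq_extension e he h2 A hA hdet W V hWn hW hV hWV f
  simp only [hext, ← hqdef]
  have hcV : (Fintype.card V : ℝ) = q ^ n := by rw [card_eq_pow_of_finrank hVn]; push_cast; rfl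
  have hcW : (Fintype.card W : ℝ) = q ^ n := by rw [card_eq_pow_of_finrank hWn]; push_cast; rfl
  rw [hcV, hcW]
  have hl : ∀ v' : V, ∀ t : F, ((q ^ (3 * n))⁻¹ * ∑ v : V,
      ‖∑ w : W, f (w + v) * e (formOf A w (v' + (t * 2) • v : V))‖ ^ 2) ^ r =
      ((q ^ (n + 1)) ^ 3)⁻¹ * (∑ v, h v (v' + (t * 2) • v)) ^ r := by
    intro v' t
    rw [Real.mul_rpow (by positivity) (by positivity), Real.inv_rpow (by positivity),
      mul_comm 3 n, pow_mul, ← Real.rpow_natCast (q ^ n) 3, ← Real.rpow_mul (by positivity),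
      mul_comm _ r, Real.rpow_mul (by positivity), hqr, Real.rpow_natCast]
  simp only [hl, ← Finset.mul_sum]
  have hright : ∀ v : V, ((q ^ n)⁻¹ * ∑ w : W, ‖f (w + v)‖ ^ 2) ^ r =
      (q ^ (n + 1))⁻¹ * a v ^ r := fun v => by
    rw [Real.mul_rpow (by positivity) (by positivity), Real.inv_rpow (by positivity), hqr]
  have hmid : ∀ v : V, (q ^ n * a v) ^ r = q ^ (n + 1) * a v ^ r := fun v => by
    rw [Real.mul_rpow (by positivity) (ha0 v), hqr]
  simp only [hright, ← Finset.mul_sum]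
  simp only [hmid, ← Finset.mul_sum] at hlines
  -- Both sides carry `q ^ (-2n - 1)`, so the constant is free of `q`.
  calc _ ≤ ((q ^ (n + 1)) ^ 3)⁻¹ * (K * q * (q ^ (n + 1) * ∑ v, a v ^ r)) :=
        mul_le_mul_of_nonneg_left hlines (by positivity)
    _ = _ := by
        field_simp
        ring

end extension

/-! ### The restriction estimates by duality -/

section restriction
variable {F : Type*} [Field F] [Fintype F]

theorem sum_mul_le_mixedNormSpace_mul {m : ℕ} {W V : Submodule F (Fin m → F)} (hWV : IsCompl W V)
    {s s' : ℝ} (hss : s'.HolderConjugate s) (f g : (Fin m → F) × F → ℂ) :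
    ∑ z, ‖f z‖ * ‖g z‖ ≤ mixedNormSpace W V 2 s' f * mixedNormSpace W V 2 s g := by
  classical
  let a : ((Fin m → F) × F → ℂ) → V × F → ℝ := fun f x =>
    ∑ w : W, ‖f ((w : Fin m → F) + (x.1 : Fin m → F), x.2)‖ ^ (2 : ℝ)
  have ha : ∀ f x, 0 ≤ a f x := fun f x => Finset.sum_nonneg fun _ _ => by positivity
  have hnorm : ∀ (f : (Fin m → F) × F → ℂ) (p : ℝ),
      mixedNormSpace W V 2 p f = (∑ x, ((a f x) ^ (1 / 2 : ℝ)) ^ p) ^ (1 / p) := by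
    intro f p
    rw [mixedNormSpace, Fintype.sum_prod_type]
    congr 1
    refine Finset.sum_congr rfl fun v _ => Finset.sum_congr rfl fun t _ => ?_
    rw [← Real.rpow_mul (ha _ _)]
    congr 1
    ring
  calc ∑ z, ‖f z‖ * ‖g z‖
      = ∑ x : V × F, ∑ w : W, ‖f ((w : Fin m → F) + (x.1 : Fin m → F), x.2)‖ *
          ‖g ((w : Fin m → F) + (x.1 : Fin m → F), x.2)‖ := by
        rw [Fintype.sum_prod_type, sum_eq_sum_sum_of_isCompl hWV, Fintype.sum_prod_type]
        exact Finset.sum_congr rfl fun v _ => Finset.sum_comm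
    _ ≤ ∑ x : V × F, (a f x) ^ (1 / 2 : ℝ) * (a g x) ^ (1 / 2 : ℝ) :=
        Finset.sum_le_sum fun x _ => Real.inner_le_Lp_mul_Lq_of_nonneg _
          Real.HolderConjugate.two_two (fun _ _ => norm_nonneg _) (fun _ _ => norm_nonneg _)
    _ ≤ _ := by
        rw [hnorm, hnorm]
        exact Real.inner_le_Lp_mul_Lq_of_nonneg _ hss (fun x _ => Real.rpow_nonneg (ha _ _) _)
          (fun x _ => Real.rpow_nonneg (ha _ _) _)

/-- Restriction is adjoint to extension; the power of `q` undoes the normalization of the surface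
measure. -/
theorem sum_restrict_mul_conj {m : ℕ} (e : AddChar F ℂ) (f : (Fin m → F) × F → ℂ)
    (φ : (Fin m → F) → ℂ) :
    ∑ ξ, restrictParaboloid (fourierTransform e f) ξ * starRingEnd ℂ (φ ξ) =
      (Fintype.card F : ℂ) ^ m * ∑ z, f z * starRingEnd ℂ (extension e 1 φ z) := by
  have hq : (Fintype.card F : ℂ) ≠ 0 := by exact_mod_cast Fintype.card_ne_zero
  have h1 : ∀ z, (Fintype.card F : ℂ) ^ m * (f z * starRingEnd ℂ (extension e 1 φ z)) =
      ∑ ξ, f z * e (-(z.1 ⬝ᵥ ξ + z.2 * (ξ ⬝ᵥ ξ))) * starRingEnd ℂ (φ ξ) := by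
    intro z
    rw [extension, map_mul, map_sum, map_inv₀, map_pow, Complex.conj_natCast]
    have hcancel : ∀ a b : ℂ, (Fintype.card F : ℂ) ^ m *
        (a * (((Fintype.card F : ℂ) ^ m)⁻¹ * b)) = a * b := fun a b => by field_simp
    rw [hcancel, Finset.mul_sum]
    refine Finset.sum_congr rfl fun ξ _ => ?_
    rw [map_mul, ← AddChar.map_neg_eq_conj, formOf, formOf, Matrix.one_mulVec, Matrix.one_mulVec,
      dotProduct_comm ξ z.1, mul_comm (ξ ⬝ᵥ ξ)]
    ring
  rw [Finset.mul_sum]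
  simp only [h1]
  rw [Finset.sum_comm]
  refine Finset.sum_congr rfl fun ξ _ => ?_
  rw [restrictParaboloid, fourierTransform, Finset.sum_mul]

/-- By duality, a mixed norm extension estimate for the paraboloid implies a mixed norm restriction
estimate. -/
theorem restriction_of_extension {k : ℕ} (e : AddChar F ℂ) {W V : Submodule F (Fin (2 * k) → F)}
    (hWV : IsCompl W V) (hW : Module.finrank F W = k) (hV : Module.finrank F V = k)
    {s s' : ℝ} (hss : s'.HolderConjugate s) {C : ℝ} (hC : 0 ≤ C)
    (hext : ∀ φ : (Fin (2 * k) → F) → ℂ,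
      mixedNormSpace W V 2 s (extension e 1 φ) ≤ C * mixedNormSurface W V 2 s φ)
    (f : (Fin (2 * k) → F) × F → ℂ) :
    mixedNormSurface W V 2 s' (restrictParaboloid (fourierTransform e f)) ≤
      C * mixedNormSpace W V 2 s' f := by
  classical
  have hq : (0 : ℝ) < Fintype.card F := by exact_mod_cast Fintype.card_pos
  have hs'1 := hss.lt
  have hs' := hss.pos
  have hs := hss.symm.pos
  set R := restrictParaboloid (fourierTransform e f)
  have hcV : (Fintype.card V : ℝ) = (Fintype.card F : ℝ) ^ k := by
    rw [card_eq_pow_of_finrank hV]; push_cast; rfl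
  have hcW : (Fintype.card W : ℝ) = (Fintype.card F : ℝ) ^ k := by
    rw [card_eq_pow_of_finrank hW]; push_cast; rfl
  set Q : ℝ := (Fintype.card F : ℝ) ^ k with hQ
  have hQ0 : 0 < Q := by positivity
  let a : V → ℝ := fun v => Q⁻¹ * ∑ w : W, ‖R ((w : Fin (2 * k) → F) + (v : Fin (2 * k) → F))‖ ^ (2 : ℝ)
  have ha : ∀ v, 0 ≤ a v := fun v =>
    mul_nonneg (by positivity) (Finset.sum_nonneg fun _ _ => by positivity)
  set T : ℝ := Q⁻¹ * ∑ v, a v ^ (s' / 2) with hT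
  have hT0 : 0 ≤ T :=
    mul_nonneg (by positivity) (Finset.sum_nonneg fun v _ => Real.rpow_nonneg (ha v) _)
  let p : (Fin (2 * k) → F) → V := fun ξ => ((Submodule.prodEquivOfIsCompl W V hWV).symm ξ).2
  have hp : ∀ (w : W) (v : V), p ((w : Fin (2 * k) → F) + (v : Fin (2 * k) → F)) = v := by
    intro w v
    have : (w : Fin (2 * k) → F) + (v : Fin (2 * k) → F) = Submodule.prodEquivOfIsCompl W V hWV (w, v) := by
      simp
    simp only [p]
    rw [this, LinearEquiv.symm_apply_apply]
  -- The extremal function for the duality of mixed norms: `R` reweighted on each fibre by a power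
  -- of its mean square `a`. Then its norm is `T ^ (1 / s)` and its pairing with `R` is `Q ^ 2 * T`.
  let φ : (Fin (2 * k) → F) → ℂ := fun ξ => R ξ * ((a (p ξ) ^ (s' / 2 - 1) : ℝ) : ℂ)
  have hRa : ∀ v : V, ∑ w : W, ‖R ((w : Fin (2 * k) → F) + (v : Fin (2 * k) → F))‖ ^ (2 : ℝ) =
      Q * a v := fun v => by
    simp only [a]
    rw [mul_inv_cancel_left₀ hQ0.ne']
  have hφ : mixedNormSurface W V 2 s φ = T ^ (1 / s) := by
    rw [mixedNormSurface, hcV, hcW, hT]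
    congr 2
    refine Finset.sum_congr rfl fun v _ => ?_
    have h1 : Q⁻¹ * ∑ w : W, ‖φ ((w : Fin (2 * k) → F) + (v : Fin (2 * k) → F))‖ ^ (2 : ℝ) =
        a v * (a v ^ (s' / 2 - 1)) ^ 2 := by
      have hb : ∀ w : W, ‖φ ((w : Fin (2 * k) → F) + (v : Fin (2 * k) → F))‖ ^ (2 : ℝ) =
          ‖R ((w : Fin (2 * k) → F) + (v : Fin (2 * k) → F))‖ ^ (2 : ℝ) *
            (a v ^ (s' / 2 - 1)) ^ 2 := fun w => by
        simp only [φ]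
        rw [hp, norm_mul, Complex.norm_real, Real.norm_of_nonneg (Real.rpow_nonneg (ha v) _),
          Real.rpow_two, Real.rpow_two, mul_pow]
      simp only [hb]
      rw [← Finset.sum_mul, hRa, mul_assoc, inv_mul_cancel_left₀ hQ0.ne']
    rw [h1]
    -- The exponent `s' / 2 - 1` may be negative, but where `a v = 0` the factor `a v` makes the
    -- value of that power irrelevant.
    rcases (ha v).eq_or_lt with h0 | h0
    · rw [← h0, zero_mul, Real.zero_rpow (by positivity), Real.zero_rpow (by positivity)]
    · have h2 : a v * (a v ^ (s' / 2 - 1)) ^ 2 = a v ^ (s' - 1) := by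
        rw [← Real.rpow_natCast, ← Real.rpow_mul h0.le]
        nth_rewrite 1 [← Real.rpow_one (a v)]
        rw [← Real.rpow_add h0]
        congr 1
        push_cast
        ring
      rw [h2, ← Real.rpow_mul h0.le]
      congr 1
      have := hss.sub_one_mul_conj
      linear_combination this / 2
  have hpair : ∑ ξ, R ξ * starRingEnd ℂ (φ ξ) = ((Q ^ 2 * T : ℝ) : ℂ) := by
    have h1 : ∀ ξ, R ξ * starRingEnd ℂ (φ ξ) =
        ((‖R ξ‖ ^ (2 : ℝ) * a (p ξ) ^ (s' / 2 - 1) : ℝ) : ℂ) := fun ξ => by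
      simp only [φ, map_mul, Complex.conj_ofReal]
      rw [← mul_assoc, Complex.mul_conj, Complex.normSq_eq_norm_sq, Real.rpow_two]
      push_cast
      rfl
    simp only [h1]
    rw [← Complex.ofReal_sum, sum_eq_sum_sum_of_isCompl hWV, hT]
    congr 1
    simp only [hp, ← Finset.sum_mul]
    rw [pow_two, mul_assoc, mul_inv_cancel_left₀ hQ0.ne', Finset.mul_sum]
    refine Finset.sum_congr rfl fun v _ => ?_
    rw [hRa, mul_assoc]
    congr 1
    rcases (ha v).eq_or_lt with h0 | h0
    · rw [← h0, zero_mul, Real.zero_rpow (by positivity)]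
    · nth_rewrite 1 [← Real.rpow_one (a v)]
      rw [← Real.rpow_add h0]
      congr 1
      ring
  have hle : T ≤ mixedNormSpace W V 2 s' f * (C * T ^ (1 / s)) := by
    have h1 := sum_restrict_mul_conj e f φ
    rw [hpair] at h1
    have hpow : (Fintype.card F : ℝ) ^ (2 * k) = Q ^ 2 := by rw [mul_comm, pow_mul]
    have h2 := congrArg norm h1
    rw [Complex.norm_real, Real.norm_eq_abs, abs_of_nonneg (show 0 ≤ Q ^ 2 * T from mul_nonneg (sq_nonneg Q) hT0),
      norm_mul, norm_pow, Complex.norm_natCast, hpow] at h2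
    have h3 := mul_left_cancel₀ (pow_pos hQ0 2).ne' h2
    rw [← hφ]
    refine h3.le.trans ?_
    refine (norm_sum_le _ _).trans ?_
    simp only [norm_mul, RCLike.norm_conj]
    refine (sum_mul_le_mixedNormSpace_mul hWV hss f _).trans ?_
    refine mul_le_mul_of_nonneg_left (hext φ) ?_
    rw [mixedNormSpace]
    exact Real.rpow_nonneg (Finset.sum_nonneg fun _ _ => Finset.sum_nonneg fun _ _ =>
      Real.rpow_nonneg (Finset.sum_nonneg fun _ _ => by positivity) _) _
  have hN : 0 ≤ mixedNormSpace W V 2 s' f := by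
    rw [mixedNormSpace]
    exact Real.rpow_nonneg (Finset.sum_nonneg fun _ _ => Finset.sum_nonneg fun _ _ =>
      Real.rpow_nonneg (Finset.sum_nonneg fun _ _ => by positivity) _) _
  have hgoal : mixedNormSurface W V 2 s' R = T ^ (1 / s') := by
    rw [mixedNormSurface, hcV, hcW]
  rw [hgoal]
  rcases hT0.eq_or_lt with h0 | h0
  · rw [← h0, Real.zero_rpow (by positivity)]
    positivity
  · have hTs : 0 < T ^ (1 / s) := Real.rpow_pos_of_pos h0 _
    refine le_of_mul_le_mul_right ?_ hTs
    rw [← Real.rpow_add h0]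
    have : 1 / s' + 1 / s = 1 := by
      have := hss.inv_add_inv_eq_one
      simpa [one_div] using this
    rw [this, Real.rpow_one]
    linarith

/-- The norm of `L^p(dσ)` is at most the mixed norm of `L^p_V L^2_W(dσ)` when `p ≤ 2`. -/
theorem normSurface_le_mixedNormSurface {k : ℕ} {W V : Submodule F (Fin (2 * k) → F)}
    (hWV : IsCompl W V) (hW : Module.finrank F W = k) (hV : Module.finrank F V = k)
    {p : ℝ} (hp : 0 < p) (hp2 : p ≤ 2) (g : (Fin (2 * k) → F) → ℂ) :
    normSurface p g ≤ mixedNormSurface W V 2 p g := by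
  classical
  have hq : (0 : ℝ) < Fintype.card F := by exact_mod_cast Fintype.card_pos
  have hcV : (Fintype.card V : ℝ) = (Fintype.card F : ℝ) ^ k := by
    rw [card_eq_pow_of_finrank hV]; push_cast; rfl
  have hcW : (Fintype.card W : ℝ) = (Fintype.card F : ℝ) ^ k := by
    rw [card_eq_pow_of_finrank hW]; push_cast; rfl
  rw [normSurface, mixedNormSurface, hcV, hcW, sum_eq_sum_sum_of_isCompl hWV]
  rw [show (Fintype.card F : ℝ) ^ (2 * k) = (Fintype.card F : ℝ) ^ k * (Fintype.card F : ℝ) ^ k by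
    rw [two_mul, pow_add]]
  set Q : ℝ := (Fintype.card F : ℝ) ^ k with hQ
  have hQ0 : 0 < Q := by positivity
  refine Real.rpow_le_rpow (by positivity) ?_ (by positivity)
  rw [mul_inv, mul_assoc, Finset.mul_sum]
  refine mul_le_mul_of_nonneg_left (Finset.sum_le_sum fun v _ => ?_) (by positivity)
  -- Jensen on one fibre, with uniform weights and the convex power `2 / p ≥ 1`.
  have h := Real.rpow_arith_mean_le_arith_mean_rpow Finset.univ (fun _ : W => Q⁻¹)
    (fun w => ‖g ((w : Fin (2 * k) → F) + (v : Fin (2 * k) → F))‖ ^ p) (fun _ _ => by positivity)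
    (by rw [Finset.sum_const, Finset.card_univ, nsmul_eq_mul, hcW, mul_inv_cancel₀ hQ0.ne'])
    (fun _ _ => by positivity) (p := 2 / p) (by rw [le_div_iff₀ hp]; linarith)
  have h1 : ∀ w : W, (‖g ((w : Fin (2 * k) → F) + (v : Fin (2 * k) → F))‖ ^ p) ^ (2 / p) =
      ‖g ((w : Fin (2 * k) → F) + (v : Fin (2 * k) → F))‖ ^ (2 : ℝ) := fun w => by
    rw [← Real.rpow_mul (norm_nonneg _), mul_div_cancel₀ _ hp.ne']
  simp only [h1, ← Finset.mul_sum] at h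
  have h2 := Real.rpow_le_rpow (by positivity) h (show 0 ≤ p / 2 by positivity)
  rw [← Real.rpow_mul (by positivity), show 2 / p * (p / 2) = 1 by field_simp, Real.rpow_one] at h2
  exact h2

end restriction

theorem mainTheorem6 (n d : ℕ) (hn : 1 ≤ n) (hd : d = 2 * n + 1) :
    ∃ C : ℝ, 0 < C ∧
      ∀ (F : Type*) [Field F] [Fintype F], ringChar F ≠ 2 →
        ∀ e : AddChar F ℂ, e ≠ 1 →
          -- the extension estimate, for every non-degenerate form of Witt index `n`
          (∀ A : Matrix (Fin (2 * n)) (Fin (2 * n)) F, A.IsSymm → IsUnit A.det →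
            ∀ W V : Submodule F (Fin (2 * n) → F),
              Module.finrank F W = n → Module.finrank F V = n →
              TotallyIsotropic A W → TotallyIsotropic A V → IsCompl W V →
              ∀ f : (Fin (2 * n) → F) → ℂ,
                mixedNormSpace W V 2 ((2 * (d : ℝ) + 2) / ((d : ℝ) - 1)) (extension e A f) ≤
                  C * mixedNormSurface W V 2 ((2 * (d : ℝ) + 2) / ((d : ℝ) - 1)) f) ∧
          -- the restriction estimates for the paraboloid
          (∀ W V : Submodule F (Fin (2 * n) → F),
              Module.finrank F W = n → Module.finrank F V = n →
              TotallyIsotropic 1 W → TotallyIsotropic 1 V → IsCompl W V →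
              ∀ f : (Fin (2 * n) → F) × F → ℂ,
                mixedNormSurface W V 2 ((2 * (d : ℝ) + 2) / ((d : ℝ) + 3))
                    (restrictParaboloid (fourierTransform e f)) ≤
                  C * mixedNormSpace W V 2 ((2 * (d : ℝ) + 2) / ((d : ℝ) + 3)) f ∧
                normSurface ((2 * (d : ℝ) + 2) / ((d : ℝ) + 3))
                    (restrictParaboloid (fourierTransform e f)) ≤
                  C * mixedNormSpace W V 2 ((2 * (d : ℝ) + 2) / ((d : ℝ) + 3)) f) := by
  have hn0 : (0 : ℝ) < n := by exact_mod_cast hn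
  set s : ℝ := (2 * (d : ℝ) + 2) / ((d : ℝ) - 1) with hs
  set s' : ℝ := (2 * (d : ℝ) + 2) / ((d : ℝ) + 3) with hs'
  have hdn : (d : ℝ) = 2 * n + 1 := by rw [hd]; push_cast; ring
  have hsn : s = (2 * n + 2) / n := by rw [hs, hdn]; field_simp; ring
  have hs'n : s' = (2 * n + 2) / (n + 2) := by rw [hs', hdn]; field_simp; ring
  have hss : s'.HolderConjugate s := by
    rw [Real.holderConjugate_iff]
    refine ⟨?_, ?_⟩
    · rw [hs'n, lt_div_iff₀ (by positivity)]; linarith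
    · rw [hsn, hs'n]; field_simp; ring
  have hs2 : s / 2 = ((n : ℝ) + 1) / n := by rw [hsn]; field_simp
  have hs'2 : s' ≤ 2 := by rw [hs'n, div_le_iff₀ (by positivity)]; linarith
  -- The Kakeya constant to the power `1 / n` from its dual form, then `1 / s` from the outer norm;
  -- duality and Jensen lose nothing.
  refine ⟨((4 ^ (n + 1) * (n : ℝ) ^ n) ^ (1 / (n : ℝ))) ^ (1 / s), by positivity, ?_⟩
  intro F _ _ hF e he
  have h2 : (2 : F) ≠ 0 := Ring.two_ne_zero hF
  refine ⟨fun A hA hdet W V hWn hVn hW hV hWV f =>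
    extension_mixedNorm_le hn e he h2 A hA hdet W V hWn hVn hW hV hWV f s hs2, ?_⟩
  intro W V hWn hVn hW hV hWV f
  have h := restriction_of_extension e hWV hWn hVn hss (by positivity)
    (fun φ => extension_mixedNorm_le hn e he h2 1 Matrix.isSymm_one (by simp) W V hWn hVn hW hV
      hWV φ s hs2) f
  exact ⟨h, (normSurface_le_mixedNormSurface hWV hWn hVn hss.pos hs'2 _).trans h⟩
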